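/- Let $K$ be a field and let $X_1,\dots,X_n$ be discrete random variables on $a_1,\dots,a_n$ states, respectively, with joint probability tensor $P=(P(X_1=x_1,\dots,X_n=x_n))_{x}$. Let $K[p_x]$ be the polynomial ring with one variable for each multi-index $x=(x_1,\dots,x_n)$, $1\le x_k\le a_k$. For $i,j\in\{1,\dots,n\}$ let $$\mathcal C_{i,j}=\{\,X_i\perp\!\!\!\perp (X_k)_{k\ne i},\ X_j\perp\!\!\!\perp (X_k)_{k\neq j}\,\},$$ and let $I_{\mathcal C_{i,j}}\subseteq K[p_x]$ be its independence ideal. Here a statement $X_S\perp\!\!\!\perp X_T$ with $S\cap T=\emptyset$ contributes all 2-minors of the matrix whose rows are the joint states of $X_S$, whose columns are the joint states of $X_T$, and whose entry at $(s,t)$ is the sum of all variables $p_x$ with $x_S=s$ and $x_T=t$. (Thus the statements of $\mathcal C_{i,j}$ hold for $X_1,\dots,X_n$ if and only if $P$ is a zero of the ideal $I_{\mathcal C_{i,j}}$ taken over $\mathbb R$.) Then: 1. If $i\ne j$, then $I_{\mathcal C_{i,j}}$ is the double determinantal ideal $I_{2,2}$: if $Y_1,\dots,Y_r$ are the $a_i\times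 a_j$ slices of the tensor of variables $(p_x)$, obtained by fixing all the indices other than the $i$-th and the $j$-th, listed in any order, then $I_{\mathcal C_{i,j}}$ is generated by the 2-minors of the two block matrices $$[\,Y_1|\cdots|Y_r\,]\quad\text{and}\quad \begin{bmatrix}Y_1\\ \vdots\\ Y_r\end{bmatrix}.$$ 2. For a given $k$, a $k$-th flattening matrix is an $a_k\times\prod_{l\neq k}a_l$ matrix whose rows are indexed by the $k$-th index and whose columns are indexed, in some order, by the tuples of all the other indices, with the variables $p_x$ as entries. For all $i,j$, the ideal $I_{\mathcal C_{i,j}}$ is generated by the 2-minors of an $i$-th and a $j$-th flattening matrix, and these minors form a Gröbner basis with respect to an appropriate monomial order; one order serves for all choices of the two flattening matrices. -/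

import Mathlib

open MeasureTheory ProbabilityTheory

noncomputable section

namespace TensorIndep

/-- Multi-indices of a tensor of type `a 0 × ⋯ × a (n-1)`. -/
abbrev Index {n : ℕ} (a : Fin n → ℕ) : Type := ∀ k, Fin (a k)

/-- The polynomial ring `K[p_x]` with one variable for each multi-index `x`. -/
abbrev TensorRing (K : Type*) [Field K] {n : ℕ} (a : Fin n → ℕ) : Type _ :=
  MvPolynomial (Index a) K

/-! ### Minors and Gröbner bases -/

/-- `D_u(M)`: the set of `u`-minors of a matrix, where the rows and the columns of each
submatrix are kept in their order. -/
def minors {R : Type*} [CommRing R] {p q : ℕ} (u : ℕ) (M : Matrix (Fin p) (Fin q) R) : Set R :=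
  {d | ∃ (f : Fin u ↪o Fin p) (g : Fin u ↪o Fin q), d = (M.submatrix f g).det}

/-- The `u`-minors of a matrix whose rows and columns carry no order; each minor
occurs with both signs. -/
def unorderedMinors {R : Type*} [CommRing R] {p q : Type*} (u : ℕ) (M : Matrix p q R) : Set R :=
  {d | ∃ (f : Fin u ↪ p) (g : Fin u ↪ q), d = (M.submatrix f g).det}

/-- A finite set `G` is a Gröbner basis (of the ideal it generates) for the monomial order `m`
if the leading terms of its elements generate the initial ideal. -/
def IsGroebnerBasis {σ K : Type*} [Field K] (m : MonomialOrder σ)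
    (G : Set (MvPolynomial σ K)) : Prop :=
  G.Finite ∧
    Ideal.span (m.leadingTerm '' (Ideal.span G : Set (MvPolynomial σ K))) =
      Ideal.span (m.leadingTerm '' G)

/-! ### Independence statements, their models and their ideals -/

/-- A statement "the variables in `left` are jointly independent of the variables in `right`". -/
structure IndepStatement (n : ℕ) where
  /-- the variables on the left -/
  left : Finset (Fin n)
  /-- the variables on the right -/
  right : Finset (Fin n)
  /-- the two groups of variables do not intersect -/
  disj : Disjoint left right

/-- The statement holds for the random variables `X`. -/
def IndepStatement.Holds {n : ℕ} (s : IndepStatement n) {a : Fin n → ℕ} {Ω : Type*}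
    [MeasurableSpace Ω] (μ : Measure Ω) (X : ∀ k, Ω → Fin (a k)) : Prop :=
  IndepFun (fun ω => s.left.restrict (fun k => X k ω))
    (fun ω => s.right.restrict (fun k => X k ω)) μ

/-- The probability tensor `P`, with entries `p_x = P(X_1 = x_1, …, X_n = x_n)`. -/
def probTensor {n : ℕ} {a : Fin n → ℕ} {Ω : Type*} [MeasurableSpace Ω] (μ : Measure Ω)
    (X : ∀ k, Ω → Fin (a k)) : Index a → ℝ :=
  fun x => μ.real {ω | ∀ k, X k ω = x k}

/-- The matrix of an independence statement. The tensor of variables is contracted along the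
indices that do not occur in the statement; the rows of the matrix are the joint states of the
variables on the left, its columns those of the variables on the right. -/
def IndepStatement.matrix {n : ℕ} (s : IndepStatement n) (K : Type*) [Field K] (a : Fin n → ℕ) :
    Matrix (∀ k : s.left, Fin (a k)) (∀ k : s.right, Fin (a k)) (TensorRing K a) :=
  Matrix.of fun u v =>
    ∑ x : Index a with s.left.restrict x = u ∧ s.right.restrict x = v, MvPolynomial.X x

/-- The independence ideal of a set of independence statements: it is generated by the 2-minors
of the matrices of the statements. -/
def indepIdeal (K : Type*) [Field K] {n : ℕ} (a : Fin n → ℕ) (C : Set (IndepStatement n)) :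
    Ideal (TensorRing K a) :=
  Ideal.span (⋃ s ∈ C, unorderedMinors 2 (s.matrix K a))

/-- The statement "`X_i` is independent of all the other variables". -/
def oneVsRest {n : ℕ} (i : Fin n) : IndepStatement n where
  left := {i}
  right := {i}ᶜ
  disj := disjoint_compl_right

/-! ### Flattenings and double determinantal ideals -/

/-- The `i`-th flattening matrix of the tensor of variables, where the columns are ordered
by an enumeration `e` of the tuples of all the other indices. -/
def flattening (K : Type*) [Field K] {n : ℕ} (a : Fin n → ℕ) (i : Fin n) {N : ℕ}
    (e : Fin N ≃ (∀ k : {k : Fin n // k ≠ i}, Fin (a k))) :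
    Matrix (Fin (a i)) (Fin N) (TensorRing K a) :=
  Matrix.of fun s c =>
    MvPolynomial.X ((Equiv.piSplitAt i (fun k => Fin (a k))).symm (s, e c))

/-- The slice of the tensor of variables in the directions `i` and `j` (for `i ≠ j`): the matrix
that is obtained by fixing all the other indices. -/
def slice (K : Type*) [Field K] {n : ℕ} (a : Fin n → ℕ) (i j : Fin n)
    (b : ∀ k : {k : Fin n // k ≠ i ∧ k ≠ j}, Fin (a k)) :
    Matrix (Fin (a i)) (Fin (a j)) (TensorRing K a) :=
  Matrix.of fun s t => MvPolynomial.X fun k =>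
    if hi : k = i then hi ▸ s else if hj : k = j then hj ▸ t else b ⟨k, hi, hj⟩

/-- The block matrix `A = [Y 0 | Y 1 | ⋯ | Y (r-1)]`. -/
def blockRow {R : Type*} {p q r : ℕ} (Y : Fin r → Matrix (Fin p) (Fin q) R) :
    Matrix (Fin p) (Fin (r * q)) R :=
  Matrix.of fun s c => Y (finProdFinEquiv.symm c).1 s (finProdFinEquiv.symm c).2

/-- The block matrix `B` in which `Y 0, Y 1, …, Y (r-1)` are stacked from top to bottom. -/
def blockCol {R : Type*} {p q r : ℕ} (Y : Fin r → Matrix (Fin p) (Fin q) R) :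
    Matrix (Fin (r * p)) (Fin q) R :=
  Matrix.of fun c t => Y (finProdFinEquiv.symm c).1 (finProdFinEquiv.symm c).2 t

/-- The double determinantal ideal `I_{u,v}` of the matrices `Y 0, …, Y (r-1)`: it is generated
by the `u`-minors of `[Y 0 | ⋯ | Y (r-1)]` and the `v`-minors of the stacked matrix. -/
def doubleDetIdeal {R : Type*} [CommRing R] {p q r : ℕ} (Y : Fin r → Matrix (Fin p) (Fin q) R)
    (u v : ℕ) : Ideal R :=
  Ideal.span (minors u (blockRow Y) ∪ minors v (blockCol Y))

end TensorIndep

end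

/-! Flattenings, block matrices of slices and the independence matrices all arrange the same
variables, with rows given by one position `l` and columns by the rest. Hence their 2-minors are, up
to sign, the same binomials, which exchange the entries of two multi-indices at `l`
(`unorderedMinors_eq_swapMinors`), so the ideals agree. The link with probability is that a joint
distribution is a product exactly when its table has rank at most one (`IndepStatement.holds_iff`).

For the Gröbner basis, label a multi-index by its entries at `i` and `j` and by a rank of its
remaining entries. An exchange preserves the multiset of labels of each kind, so the binomials are
homogeneous for this fine grading and lie in its toric ideal. In the reverse lexicographic order,
two variables whose labels are incomparable form a leading monomial, so standard monomials are
multichains. A multichain is recovered from its multidegree by removing least elements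
(`IsMultichain.eq_of_multidegree_eq`), so each fibre has at most one standard monomial; this
suffices by `isGroebnerBasis_of_unique_standard`. -/

namespace TensorIndep

/-! ### Multichains in the fibres of the multigrading -/

section Fibres

/-- The multidegree of an exponent vector with respect to a family of labellings of the
variables: the multisets of labels that occur. -/
noncomputable def multidegree {σ T : Type*} (lab : T → σ → ℕ) : (σ →₀ ℕ) →+ (T → ℕ →₀ ℕ) :=
  AddMonoidHom.pi fun t => Finsupp.mapDomain.addMonoidHom (lab t)

lemma multidegree_apply {σ T : Type*} (lab : T → σ → ℕ) (u : σ →₀ ℕ) (t : T) :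
    multidegree lab u t = Finsupp.mapDomain (lab t) u := rfl

/-- An exponent vector is a multichain if its support is totally ordered by the labellings. -/
def IsMultichain {σ T : Type*} (lab : T → σ → ℕ) (u : σ →₀ ℕ) : Prop :=
  ∀ x ∈ u.support, ∀ y ∈ u.support, (∀ t, lab t x ≤ lab t y) ∨ ∀ t, lab t y ≤ lab t x

lemma mapDomain_apply_ne_zero {σ β : Type*} (f : σ → β) {u : σ →₀ ℕ} {x : σ}
    (hx : x ∈ u.support) : Finsupp.mapDomain f u (f x) ≠ 0 := by
  have h1 : Finsupp.single x 1 ≤ u := by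
    rw [Finsupp.single_le_iff]
    exact Nat.one_le_iff_ne_zero.2 (Finsupp.mem_support_iff.1 hx)
  obtain ⟨w, rfl⟩ := exists_add_of_le h1
  rw [Finsupp.mapDomain_add, Finsupp.mapDomain_single]
  simp

lemma exists_mem_support_of_mapDomain_ne_zero {σ β : Type*} {f : σ → β} {u : σ →₀ ℕ} {b : β}
    (hb : Finsupp.mapDomain f u b ≠ 0) : ∃ x ∈ u.support, f x = b := by
  by_contra! h
  exact hb (Finsupp.mapDomain_of_not_mem_image_support (by rintro ⟨x, hx, rfl⟩; exact h x hx rfl))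

/-- A minimal label vector on the finite support is least, since any two label vectors there are
comparable. -/
lemma IsMultichain.exists_least {σ T : Type*} {lab : T → σ → ℕ} {u : σ →₀ ℕ}
    (hu : IsMultichain lab u) (h0 : u ≠ 0) :
    ∃ x ∈ u.support, ∀ y ∈ u.support, ∀ t, lab t x ≤ lab t y := by
  obtain ⟨x, hx, hmin⟩ := Finset.exists_minimalFor (fun x t => lab t x) u.support
    (Finsupp.support_nonempty_iff.2 h0)
  refine ⟨x, hx, fun y hy => ?_⟩
  rcases hu x hx y hy with h | h
  · exact h
  · exact hmin hy h

lemma IsMultichain.of_add {σ T : Type*} {lab : T → σ → ℕ} {u w : σ →₀ ℕ}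
    (hu : IsMultichain lab (w + u)) : IsMultichain lab u := by
  have key : ∀ x ∈ u.support, x ∈ (w + u).support := fun x hx => by
    simp only [Finsupp.mem_support_iff, Finsupp.add_apply] at hx ⊢
    omega
  exact fun x hx y hy => hu x (key x hx) y (key y hy)

lemma eq_zero_of_multidegree_eq {σ T : Type*} [Nonempty T] {lab : T → σ → ℕ} {v : σ →₀ ℕ}
    (h : multidegree lab 0 = multidegree lab v) : v = 0 := by
  by_contra hv
  obtain ⟨x, hx⟩ := Finsupp.support_nonempty_iff.2 hv
  obtain ⟨t⟩ := ‹Nonempty T›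
  apply mapDomain_apply_ne_zero (lab t) hx
  have := DFunLike.congr_fun (congrFun h t) (lab t x)
  rw [multidegree_apply, multidegree_apply, Finsupp.mapDomain_zero] at this
  exact this.symm

lemma exists_label_eq_of_multidegree_eq {σ T : Type*} {lab : T → σ → ℕ} {u v : σ →₀ ℕ}
    (h : multidegree lab u = multidegree lab v) {x : σ} (hx : x ∈ u.support) (t : T) :
    ∃ y ∈ v.support, lab t y = lab t x := by
  apply exists_mem_support_of_mapDomain_ne_zero
  have := mapDomain_apply_ne_zero (lab t) hx
  rwa [← multidegree_apply, h, multidegree_apply] at this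

/-- A multichain is determined by its multidegree. -/
theorem IsMultichain.eq_of_multidegree_eq {σ T : Type*} [Nonempty T] {lab : T → σ → ℕ}
    (hinj : ∀ x y, (∀ t, lab t x = lab t y) → x = y) {u v : σ →₀ ℕ}
    (hu : IsMultichain lab u) (hv : IsMultichain lab v)
    (h : multidegree lab u = multidegree lab v) : u = v := by
  induction hn : u.degree generalizing u v with
  | zero =>
    obtain rfl := (Finsupp.degree_eq_zero_iff u).1 hn
    exact (eq_zero_of_multidegree_eq h).symm
  | succ n ih =>
    have hu0 : u ≠ 0 := by rintro rfl; simp at hn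
    have hv0 : v ≠ 0 := by rintro rfl; exact hu0 (eq_zero_of_multidegree_eq h.symm)
    obtain ⟨x, hx, hxmin⟩ := hu.exists_least hu0
    obtain ⟨y, hy, hymin⟩ := hv.exists_least hv0
    -- The multidegree determines the smallest label of each kind, and the least elements attain all
    -- of these at once.
    have hxy : x = y := by
      refine hinj x y fun t => le_antisymm ?_ ?_
      · obtain ⟨z, hz, hzt⟩ := exists_label_eq_of_multidegree_eq h.symm hy t
        exact hzt ▸ hxmin z hz t
      · obtain ⟨z, hz, hzt⟩ := exists_label_eq_of_multidegree_eq h hx t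
        exact hzt ▸ hymin z hz t
    subst hxy
    have one_le : ∀ w : σ →₀ ℕ, x ∈ w.support → Finsupp.single x 1 ≤ w := fun w hw => by
      rw [Finsupp.single_le_iff]
      exact Nat.one_le_iff_ne_zero.2 (Finsupp.mem_support_iff.1 hw)
    obtain ⟨u', rfl⟩ := exists_add_of_le (one_le u hx)
    obtain ⟨v', rfl⟩ := exists_add_of_le (one_le v hy)
    rw [ih hu.of_add hv.of_add (by simpa using h)]
    simp at hn
    omega

end Fibres

/-! ### Gröbner bases inside toric ideals -/

section Toric

variable {σ K D : Type*} [Field K] [AddMonoid D]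

/-- The homomorphism to the monoid algebra of the grading monoid that maps each monomial to its
degree. -/
noncomputable def toricMap (K : Type*) [Field K] (δ : (σ →₀ ℕ) →+ D) :
    MvPolynomial σ K →+* AddMonoidAlgebra K D :=
  AddMonoidAlgebra.mapDomainRingHom K δ

lemma toricMap_monomial (δ : (σ →₀ ℕ) →+ D) (u : σ →₀ ℕ) (c : K) :
    toricMap K δ (MvPolynomial.monomial u c) = AddMonoidAlgebra.single (δ u) c :=
  AddMonoidAlgebra.mapDomain_single

/-- The coefficients of `f` over each fibre sum to zero. If the leading monomial were minimal in its
fibre, its coefficient would be alone in that sum. -/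
lemma exists_degree_eq_and_lt (m : MonomialOrder σ) {δ : (σ →₀ ℕ) →+ D} {f : MvPolynomial σ K}
    (hf : toricMap K δ f = 0) (h0 : f ≠ 0) :
    ∃ u, δ u = δ (m.degree f) ∧ m.toSyn u < m.toSyn (m.degree f) := by
  classical
  by_contra! h
  have key : (toricMap K δ f).coeff (δ (m.degree f)) = m.leadingCoeff f := by
    rw [← congrArg (toricMap K δ) (MvPolynomial.support_sum_monomial_coeff f), map_sum, AddMonoidAlgebra.coeff_sum, Finsupp.finsetSum_apply,
      Finset.sum_eq_single (m.degree f)]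
    · rw [toricMap_monomial]
      simp [MonomialOrder.leadingCoeff]
    · intro u hu hne
      rw [toricMap_monomial, AddMonoidAlgebra.coeff_single, Finsupp.single_apply, if_neg]
      intro hδ
      exact hne (m.toSyn.injective (le_antisymm (m.le_degree hu) (h u hδ)))
    · intro hu
      exact absurd (m.degree_mem_support h0) hu
  rw [hf] at key
  exact (m.leadingCoeff_ne_zero_iff.2 h0) (by rw [← key]; simp)

/-- A set of elements of a toric ideal is a Gröbner basis if each fibre of the grading contains
at most one standard monomial. -/
theorem isGroebnerBasis_of_unique_standard (m : MonomialOrder σ) (δ : (σ →₀ ℕ) →+ D)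
    {G : Set (MvPolynomial σ K)} (hfin : G.Finite) (hG : ∀ g ∈ G, toricMap K δ g = 0)
    (huniq : ∀ u v : σ →₀ ℕ, (∀ g ∈ G, g ≠ 0 → ¬ m.degree g ≤ u) →
      (∀ g ∈ G, g ≠ 0 → ¬ m.degree g ≤ v) → δ u = δ v → u = v) :
    IsGroebnerBasis m G := by
  refine ⟨hfin, le_antisymm ?_ (Ideal.span_mono (Set.image_mono Ideal.subset_span))⟩
  rw [Ideal.span_le]
  rintro _ ⟨f, hf, rfl⟩
  by_cases h0 : f = 0
  · simp [h0]
  have hfker : toricMap K δ f = 0 := by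
    have : Ideal.span G ≤ RingHom.ker (toricMap K δ) := Ideal.span_le.2 hG
    exact this hf
  obtain ⟨g, hg, hg0, hdeg⟩ : ∃ g ∈ G, g ≠ 0 ∧ m.degree g ≤ m.degree f := by
    by_contra! hstd
    obtain ⟨u, hu, hlt⟩ := exists_degree_eq_and_lt m hfker h0
    -- The minimum of the fibre is standard: a leading monomial dividing it could be replaced by a
    -- smaller one of the same degree. Uniqueness then identifies it with the leading monomial of
    -- `f`, which is not minimal.
    obtain ⟨w, hw, hmin⟩ := (InvImage.wf m.toSyn (wellFounded_lt (α := m.syn))).has_min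
      {w | δ w = δ (m.degree f)} ⟨u, hu⟩
    have hwstd : ∀ g ∈ G, g ≠ 0 → ¬ m.degree g ≤ w := by
      intro g hg hg0 hle
      obtain ⟨b, hb, hblt⟩ := exists_degree_eq_and_lt m (hG g hg) hg0
      obtain ⟨t, rfl⟩ := exists_add_of_le hle
      refine hmin (b + t) ?_ ?_
      · change δ (b + t) = _
        rw [← hw, map_add, map_add, hb]
      · change m.toSyn _ < m.toSyn _
        rw [map_add, map_add]
        exact add_lt_add_left hblt _
    rw [huniq _ _ hwstd hstd hw] at hmin
    exact hmin u hu hlt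
  obtain ⟨t, ht⟩ := exists_add_of_le hdeg
  have hlc : m.leadingCoeff g ≠ 0 := m.leadingCoeff_ne_zero_iff.2 hg0
  have : m.leadingTerm f =
      MvPolynomial.monomial t (m.leadingCoeff f / m.leadingCoeff g) * m.leadingTerm g := by
    rw [MonomialOrder.leadingTerm, MonomialOrder.leadingTerm, MvPolynomial.monomial_mul, ht,
      add_comm t, div_mul_cancel₀ _ hlc]
  rw [this]
  exact Ideal.mul_mem_left _ _ (Ideal.subset_span ⟨g, hg, rfl⟩)

end Toric

/-! ### The graded reverse lexicographic order -/

section RevLex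

variable {σ : Type*} [LinearOrder σ] [Fintype σ]

/-- The partial sums of an exponent vector over the upper sets of the variables. -/
noncomputable def upperSums : (σ →₀ ℕ) →+ (σ →₀ ℕ) where
  toFun u := Finsupp.equivFunOnFinite.symm fun x => ∑ y with x ≤ y, u y
  map_zero' := by ext; simp
  map_add' u v := by ext; simp [Finset.sum_add_distrib]

lemma upperSums_apply (u : σ →₀ ℕ) (x : σ) : upperSums u x = ∑ y with x ≤ y, u y := rfl

lemma upperSums_single (x z : σ) :
    upperSums (Finsupp.single x 1) z = if z ≤ x then 1 else 0 := by
  simp [upperSums_apply, Finsupp.single_apply]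

/-- At the largest index where two vectors differ, the upper sums differ by the same amount. -/
lemma upperSums_injective : Function.Injective (upperSums (σ := σ)) := by
  intro u v h
  by_contra hne
  obtain ⟨x, hx⟩ : ∃ x, u x ≠ v x := by
    by_contra! h'
    exact hne (Finsupp.ext h')
  obtain ⟨x, hx, hmax⟩ := Finset.exists_maximal (s := {x | u x ≠ v x}) ⟨x, by simpa using hx⟩
  have h1 := DFunLike.congr_fun h x
  have hsplit : Finset.univ.filter (x ≤ ·) = insert x (Finset.univ.filter (x < ·)) := by
    ext y
    simp [le_iff_eq_or_lt, eq_comm]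
  have hrest : ∑ y with x < y, u y = ∑ y with x < y, v y := by
    refine Finset.sum_congr rfl fun y hy => ?_
    by_contra hy'
    have hxy : x < y := by simpa using hy
    exact absurd (hmax (by simpa using hy') hxy.le) (not_le.2 hxy)
  rw [upperSums_apply, upperSums_apply, hsplit, Finset.sum_insert (by simp),
    Finset.sum_insert (by simp), hrest] at h1
  simp at hx
  omega

/-- The graded reverse lexicographic order, in which smaller indices are smaller variables. It
compares exponent vectors by their upper sums, lexicographically. -/
noncomputable def degRevLex (σ : Type*) [LinearOrder σ] [Fintype σ] : MonomialOrder σ :=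
  -- The sum at the smallest index is the total degree; each later sum drops one more small
  -- variable, so a larger sum means fewer small variables. Additivity of `upperSums` transfers the
  -- axioms from the lexicographic order.
  letI lo : LinearOrder (σ →₀ ℕ) := LinearOrder.lift'
    (fun u => (MonomialOrder.lex (σ := σ)).toSyn (upperSums u))
    ((MonomialOrder.lex (σ := σ)).toSyn.injective.comp upperSums_injective)
  { syn := σ →₀ ℕ
    addCommMonoidSyn := inferInstance
    linearOrderSyn := lo
    isOrderedAddMonoid_syn := by
      refine @IsOrderedAddMonoid.mk (σ →₀ ℕ) _ lo.toPreorder ?_ ?_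
      · intro u v h w
        change (MonomialOrder.lex (σ := σ)).toSyn (upperSums _) ≤
          (MonomialOrder.lex (σ := σ)).toSyn (upperSums _)
        simp only [map_add]
        exact add_le_add_left (α := (MonomialOrder.lex (σ := σ)).syn)
          (show (MonomialOrder.lex (σ := σ)).toSyn (upperSums u) ≤
            (MonomialOrder.lex (σ := σ)).toSyn (upperSums v) from h) _
      · intro u v h w
        change (MonomialOrder.lex (σ := σ)).toSyn (upperSums _) ≤
          (MonomialOrder.lex (σ := σ)).toSyn (upperSums _)
        simp only [map_add]
        exact add_le_add_right (α := (MonomialOrder.lex (σ := σ)).syn)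
          (show (MonomialOrder.lex (σ := σ)).toSyn (upperSums u) ≤
            (MonomialOrder.lex (σ := σ)).toSyn (upperSums v) from h) _
    toSyn := AddEquiv.refl _
    toSyn_monotone := by
      intro u v h
      obtain ⟨w, rfl⟩ := exists_add_of_le h
      change (MonomialOrder.lex (σ := σ)).toSyn (upperSums _) ≤
          (MonomialOrder.lex (σ := σ)).toSyn (upperSums _)
      simp only [map_add]
      exact MonomialOrder.le_add_right _ _ _
    wellFoundedLT_syn := ⟨InvImage.wf
      (fun u => (MonomialOrder.lex (σ := σ)).toSyn (upperSums u)) wellFounded_lt⟩ }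

lemma degRevLex_lt_iff {u v : σ →₀ ℕ} :
    (degRevLex σ).toSyn u < (degRevLex σ).toSyn v ↔
      toLex (upperSums u) < toLex (upperSums v) := Iff.rfl

/-- A quadratic monomial that contains the smallest variable is the smaller one. -/
lemma degRevLex_single_add_single_lt {x y x' y' : σ} (hy : x < y) (hx' : x < x') (hy' : x < y') :
    (degRevLex σ).toSyn (Finsupp.single x 1 + Finsupp.single y 1) <
      (degRevLex σ).toSyn (Finsupp.single x' 1 + Finsupp.single y' 1) := by
  rw [degRevLex_lt_iff, Finsupp.Lex.lt_iff]
  -- The successor of `x` is the first index where the upper sums differ: there they are 1 and 2,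
  -- before it both are 2.
  obtain ⟨z, hz⟩ : ∃ z, IsLeast {z | x < z} z := by
    have := Finset.isLeast_min' (Finset.univ.filter (x < ·)) ⟨y, by simpa using hy⟩
    exact ⟨_, by simpa only [Finset.coe_filter, Finset.mem_univ, true_and] using this⟩
  have hxz : x < z := hz.1
  refine ⟨z, fun t ht => ?_, ?_⟩
  · have htx : t ≤ x := by
      by_contra! h
      exact absurd (hz.2 h) (not_le.2 ht)
    simp [upperSums_single, htx, htx.trans hy.le, htx.trans hx'.le, htx.trans hy'.le]
  · simp [upperSums_single, hxz, hz.2 hx', hz.2 hy', hz.2 hy]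

end RevLex

/-! ### Ordered and unordered 2-minors -/

section Minors

variable {R : Type*} [CommRing R]

lemma minors_subset_unorderedMinors {p q : ℕ} (u : ℕ) (M : Matrix (Fin p) (Fin q) R) :
    minors u M ⊆ unorderedMinors u M := by
  rintro _ ⟨f, g, rfl⟩
  exact ⟨f.toEmbedding, g.toEmbedding, rfl⟩

lemma exists_minor_two {p q : ℕ} (M : Matrix (Fin p) (Fin q) R) {s s' : Fin p} {t t' : Fin q}
    (hs : s < s') (ht : t < t') : M s t * M s' t' - M s t' * M s' t ∈ minors 2 M := by
  refine ⟨OrderEmbedding.ofStrictMono ![s, s'] ?_, OrderEmbedding.ofStrictMono ![t, t'] ?_, ?_⟩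
  · simpa [Fin.strictMono_iff_lt_succ] using hs
  · simpa [Fin.strictMono_iff_lt_succ] using ht
  · rw [Matrix.det_fin_two]
    rfl

lemma exists_unorderedMinor_two {p q : Type*} (M : Matrix p q R) {s s' : p} {t t' : q}
    (hs : s ≠ s') (ht : t ≠ t') : M s t * M s' t' - M s t' * M s' t ∈ unorderedMinors 2 M := by
  refine ⟨⟨![s, s'], ?_⟩, ⟨![t, t'], ?_⟩, ?_⟩
  · simp [Function.Injective, Fin.forall_fin_two, hs, hs.symm]
  · simp [Function.Injective, Fin.forall_fin_two, ht, ht.symm]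
  · rw [Matrix.det_fin_two]
    rfl

/-- A 2-minor whose rows and columns carry no order is a 2-minor up to sign. -/
lemma mem_minors_or_neg_mem {p q : ℕ} (M : Matrix (Fin p) (Fin q) R) {d : R}
    (hd : d ∈ unorderedMinors 2 M) : d ∈ minors 2 M ∨ -d ∈ minors 2 M := by
  obtain ⟨f, g, rfl⟩ := hd
  have hf : f 0 ≠ f 1 := f.injective.ne (by decide)
  have hg : g 0 ≠ g 1 := g.injective.ne (by decide)
  simp only [Matrix.det_fin_two, Matrix.submatrix_apply]
  rcases hf.lt_or_gt with hf | hf <;> rcases hg.lt_or_gt with hg | hg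
  · exact .inl (exists_minor_two M hf hg)
  · right
    convert exists_minor_two M hf hg using 1
    ring
  · right
    convert exists_minor_two M hf hg using 1
    ring
  · left
    convert exists_minor_two M hf hg using 1
    ring

lemma span_minors_two {p q : ℕ} (M : Matrix (Fin p) (Fin q) R) :
    Ideal.span (minors 2 M) = Ideal.span (unorderedMinors 2 M) := by
  refine le_antisymm (Ideal.span_mono (minors_subset_unorderedMinors 2 M)) (Ideal.span_le.2 ?_)
  intro d hd
  rcases mem_minors_or_neg_mem M hd with h | h
  · exact Ideal.subset_span h
  · exact (Ideal.neg_mem_iff _).1 (Ideal.subset_span h)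

lemma unorderedMinors_transpose.{w} {p q : Type w} (u : ℕ) (M : Matrix p q R) :
    unorderedMinors u M.transpose = unorderedMinors u M := by
  have key : ∀ {p q : Type w} (M : Matrix p q R),
      unorderedMinors u M.transpose ⊆ unorderedMinors u M := by
    rintro p q M _ ⟨f, g, rfl⟩
    refine ⟨g, f, ?_⟩
    rw [← Matrix.det_transpose, Matrix.transpose_submatrix, Matrix.transpose_transpose]
  exact (key M).antisymm (by simpa using key M.transpose)

lemma minors_finite {p q : ℕ} (u : ℕ) (M : Matrix (Fin p) (Fin q) R) : (minors u M).Finite := by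
  refine (Set.finite_range fun fg : (Fin u ↪o Fin p) × (Fin u ↪o Fin q) =>
    (M.submatrix fg.1 fg.2).det).subset ?_
  rintro _ ⟨f, g, rfl⟩
  exact ⟨(f, g), rfl⟩

end Minors

/-! ### All generating sets as exchange binomials -/

section SwapMinors

variable (K : Type*) [Field K] {n : ℕ} (a : Fin n → ℕ)

/-- The 2-minors of the flattenings in direction `l`, without any order of rows and columns: the
entries of two multi-indices in position `l` are exchanged. -/
def swapMinors (l : Fin n) : Set (TensorRing K a) :=
  {d | ∃ x y : Index a, x l ≠ y l ∧ (∃ k, k ≠ l ∧ x k ≠ y k) ∧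
    d = MvPolynomial.X x * MvPolynomial.X y -
      MvPolynomial.X (Function.update x l (y l)) * MvPolynomial.X (Function.update y l (x l))}

variable {K a}

/-- When the row records exactly the entry at `l` and the column exactly the other entries, changing
the entry at `l` means moving to another row of the same column. The two products of a 2-minor thus
differ by an exchange at `l`. -/
lemma unorderedMinors_eq_swapMinors {p q : Type*} {l : Fin n} (E : p → q → Index a)
    (hrow : ∀ s s' t t', E s t l = E s' t' l ↔ s = s')
    (hcol : ∀ s s' t t', (∀ k, k ≠ l → E s t k = E s' t' k) ↔ t = t')
    (hsurj : ∀ x, ∃ s t, E s t = x) :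
    unorderedMinors 2 (Matrix.of fun s t => (MvPolynomial.X (E s t) : TensorRing K a)) =
      swapMinors K a l := by
  have hupd : ∀ s s' t t', Function.update (E s t) l (E s' t' l) = E s' t := by
    intro s s' t t'
    funext k
    by_cases hk : k = l
    · subst hk
      rw [Function.update_self]
      exact (hrow _ _ _ _).2 rfl
    · rw [Function.update_of_ne hk]
      exact (hcol _ _ _ _).2 rfl k hk
  ext d
  constructor
  · rintro ⟨f, g, rfl⟩
    refine ⟨E (f 0) (g 0), E (f 1) (g 1), ?_, ?_, ?_⟩
    · rw [Ne, hrow]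
      exact f.injective.ne (by decide)
    · have := (hcol (f 0) (f 1) (g 0) (g 1)).not.2 (g.injective.ne (by decide))
      push Not at this
      exact this
    · simp only [hupd, Matrix.det_fin_two, Matrix.submatrix_apply, Matrix.of_apply]
      ring
  · rintro ⟨x, y, hl, ⟨k, hk, hxy⟩, rfl⟩
    obtain ⟨s, t, rfl⟩ := hsurj x
    obtain ⟨s', t', rfl⟩ := hsurj y
    have hs : s ≠ s' := fun h => hl ((hrow _ _ _ _).2 h)
    have ht : t ≠ t' := fun h => hxy ((hcol _ _ _ _).2 h k hk)
    rw [hupd, hupd, mul_comm (MvPolynomial.X (E s' t))]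
    exact exists_unorderedMinor_two (Matrix.of fun s t => MvPolynomial.X (E s t)) hs ht

lemma unorderedMinors_flattening (i : Fin n) {N : ℕ}
    (e : Fin N ≃ (∀ k : {k : Fin n // k ≠ i}, Fin (a k))) :
    unorderedMinors 2 (flattening K a i e) = swapMinors K a i := by
  refine unorderedMinors_eq_swapMinors
    (fun s c => (Equiv.piSplitAt i (fun k => Fin (a k))).symm (s, e c)) ?_ ?_ ?_
  · intro s s' t t'
    simp
  · intro s s' t t'
    rw [← e.apply_eq_iff_eq, funext_iff, Subtype.forall]
    refine forall₂_congr fun k hk => ?_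
    simp [hk]
  · intro x
    refine ⟨x i, e.symm fun k => x k, ?_⟩
    rw [Equiv.apply_symm_apply]
    exact (Equiv.piSplitAt i (fun k => Fin (a k))).symm_apply_apply x

lemma unorderedMinors_oneVsRest (i : Fin n) :
    unorderedMinors 2 ((oneVsRest i).matrix K a) = swapMinors K a i := by
  let E : (∀ k : (oneVsRest i).left, Fin (a k)) → (∀ k : (oneVsRest i).right, Fin (a k)) →
      Index a := fun u v k =>
    if h : k = i then u ⟨k, by simpa [oneVsRest] using h⟩
    else v ⟨k, by simpa [oneVsRest] using h⟩
  have hM : (oneVsRest i).matrix K a =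
      Matrix.of fun u v => (MvPolynomial.X (E u v) : TensorRing K a) := by
    ext1 u v
    rw [IndepStatement.matrix, Matrix.of_apply, Matrix.of_apply]
    -- Every position occurs in the statement, so nothing is contracted and each entry is a single
    -- variable.
    have : (Finset.univ.filter fun x : Index a => (oneVsRest i).left.restrict x = u ∧
        (oneVsRest i).right.restrict x = v) = {E u v} := by
      ext x
      simp only [Finset.mem_filter, Finset.mem_univ, true_and, Finset.mem_singleton]
      constructor
      · rintro ⟨rfl, rfl⟩
        funext k
        simp [E]
      · rintro rfl
        constructor
        · funext k
          have hk : (k : Fin n) = i := by simpa [oneVsRest] using k.2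
          simp [E, hk]
        · funext k
          have hk : (k : Fin n) ≠ i := by simpa [oneVsRest] using k.2
          simp [E, hk]
    rw [this, Finset.sum_singleton]
  rw [hM]
  refine unorderedMinors_eq_swapMinors E ?_ ?_ ?_
  · intro s s' t t'
    simp only [E, dite_true]
    refine ⟨fun h => ?_, fun h => by rw [h]⟩
    funext ⟨k, hk⟩
    obtain rfl : k = i := by simpa [oneVsRest] using hk
    exact h
  · intro s s' t t'
    refine ⟨fun h => ?_, fun h k hk => by simp [E, hk, h]⟩
    funext ⟨k, hk⟩
    have hk' : k ≠ i := by simpa [oneVsRest] using hk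
    simpa [E, hk'] using h k hk'
  · exact fun x => ⟨fun k => x k, fun k => x k, by funext k; simp [E]⟩

/-- The multi-index with entries `s`, `t` in positions `i`, `j` and the entries of `b` elsewhere. -/
def sliceIndex (i j : Fin n) (b : ∀ k : {k : Fin n // k ≠ i ∧ k ≠ j}, Fin (a k))
    (s : Fin (a i)) (t : Fin (a j)) : Index a := fun k =>
  if hi : k = i then hi ▸ s else if hj : k = j then hj ▸ t else b ⟨k, hi, hj⟩

section SliceIndex

variable {i j : Fin n} (b : ∀ k : {k : Fin n // k ≠ i ∧ k ≠ j}, Fin (a k))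
  (s : Fin (a i)) (t : Fin (a j))

lemma sliceIndex_left : sliceIndex i j b s t i = s := by simp [sliceIndex]

lemma sliceIndex_right (hij : i ≠ j) : sliceIndex i j b s t j = t := by
  simp [sliceIndex, hij.symm]

lemma sliceIndex_of_ne {k : Fin n} (hi : k ≠ i) (hj : k ≠ j) :
    sliceIndex i j b s t k = b ⟨k, hi, hj⟩ := by
  simp [sliceIndex, hi, hj]

lemma sliceIndex_self (hij : i ≠ j) (x : Index a) :
    sliceIndex i j (fun k => x k) (x i) (x j) = x := by
  funext k
  by_cases hi : k = i
  · subst hi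
    exact sliceIndex_left _ _ _
  by_cases hj : k = j
  · subst hj
    exact sliceIndex_right _ _ _ hij
  exact sliceIndex_of_ne _ _ _ hi hj

end SliceIndex

variable {i j : Fin n} {r : ℕ} (e : Fin r ≃ (∀ k : {k : Fin n // k ≠ i ∧ k ≠ j}, Fin (a k)))

lemma unorderedMinors_blockRow (hij : i ≠ j) :
    unorderedMinors 2 (blockRow fun p => slice K a i j (e p)) = swapMinors K a i := by
  refine unorderedMinors_eq_swapMinors (fun s c => sliceIndex i j
    (e (finProdFinEquiv.symm c).1) s (finProdFinEquiv.symm c).2) ?_ ?_ ?_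
  · intro s s' t t'
    rw [sliceIndex_left, sliceIndex_left]
  · intro s s' c c'
    refine ⟨fun h => ?_, ?_⟩
    · apply finProdFinEquiv.symm.injective
      apply Prod.ext
      · apply e.injective
        funext ⟨k, hi, hj⟩
        simpa [sliceIndex_of_ne _ _ _ hi hj] using h k hi
      · simpa [sliceIndex_right _ _ _ hij] using h j hij.symm
    · rintro rfl k hk
      by_cases hj : k = j
      · subst hj
        rw [sliceIndex_right _ _ _ hij, sliceIndex_right _ _ _ hij]
      · rw [sliceIndex_of_ne _ _ _ hk hj, sliceIndex_of_ne _ _ _ hk hj]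
  · intro x
    refine ⟨x i, finProdFinEquiv (e.symm fun k => x k, x j), ?_⟩
    simpa using sliceIndex_self hij x

lemma unorderedMinors_blockCol (hij : i ≠ j) :
    unorderedMinors 2 (blockCol fun p => slice K a i j (e p)) = swapMinors K a j := by
  -- Transposing makes position `j`, which indexes the columns of the stacked matrix, index the
  -- rows.
  rw [← unorderedMinors_transpose]
  refine unorderedMinors_eq_swapMinors (fun t c => sliceIndex i j
    (e (finProdFinEquiv.symm c).1) (finProdFinEquiv.symm c).2 t) ?_ ?_ ?_
  · intro s s' t t'
    rw [sliceIndex_right _ _ _ hij, sliceIndex_right _ _ _ hij]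
  · intro s s' c c'
    refine ⟨fun h => ?_, ?_⟩
    · apply finProdFinEquiv.symm.injective
      apply Prod.ext
      · apply e.injective
        funext ⟨k, hi, hj⟩
        simpa [sliceIndex_of_ne _ _ _ hi hj] using h k hj
      · simpa [sliceIndex_left] using h i hij
    · rintro rfl k hk
      by_cases hi : k = i
      · subst hi
        rw [sliceIndex_left, sliceIndex_left]
      · rw [sliceIndex_of_ne _ _ _ hi hk, sliceIndex_of_ne _ _ _ hi hk]
  · intro x
    refine ⟨x j, finProdFinEquiv (e.symm fun k => x k, x i), ?_⟩
    simpa using sliceIndex_self hij x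

lemma indepIdeal_pair (i j : Fin n) :
    indepIdeal K a {oneVsRest i, oneVsRest j} =
      Ideal.span (swapMinors K a i ∪ swapMinors K a j) := by
  rw [indepIdeal, Set.biUnion_pair, unorderedMinors_oneVsRest, unorderedMinors_oneVsRest]

theorem indepIdeal_pair_eq_doubleDetIdeal (hij : i ≠ j) :
    indepIdeal K a {oneVsRest i, oneVsRest j} =
      doubleDetIdeal (fun p => slice K a i j (e p)) 2 2 := by
  rw [indepIdeal_pair, doubleDetIdeal, Ideal.span_union, Ideal.span_union, span_minors_two,
    span_minors_two, unorderedMinors_blockRow e hij, unorderedMinors_blockCol e hij]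

theorem indepIdeal_pair_eq_span_minors_flattening (i j : Fin n) {N N' : ℕ}
    (e : Fin N ≃ (∀ k : {k : Fin n // k ≠ i}, Fin (a k)))
    (e' : Fin N' ≃ (∀ k : {k : Fin n // k ≠ j}, Fin (a k))) :
    indepIdeal K a {oneVsRest i, oneVsRest j} =
      Ideal.span (minors 2 (flattening K a i e) ∪ minors 2 (flattening K a j e')) := by
  rw [indepIdeal_pair, Ideal.span_union, Ideal.span_union, span_minors_two,
    span_minors_two, unorderedMinors_flattening, unorderedMinors_flattening]

end SwapMinors

/-! ### Independence as vanishing of 2-minors -/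

section Model

/-- The random variables `X`, `Y` with countably many values are independent if this holds for
the events that they take given values. -/
lemma indepFun_iff_measureReal_singleton {Ω α β : Type*} [MeasurableSpace Ω] (μ : Measure Ω)
    [IsProbabilityMeasure μ] [MeasurableSpace α] [MeasurableSpace β] [Countable α] [Countable β]
    [MeasurableSingletonClass α] [MeasurableSingletonClass β] {f : Ω → α} {g : Ω → β}
    (hf : Measurable f) (hg : Measurable g) :
    IndepFun f g μ ↔ ∀ u v, μ.real (f ⁻¹' {u} ∩ g ⁻¹' {v}) =
      μ.real (f ⁻¹' {u}) * μ.real (g ⁻¹' {v}) := by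
  have key : ∀ u v, μ.real (f ⁻¹' {u} ∩ g ⁻¹' {v}) = μ.real (f ⁻¹' {u}) * μ.real (g ⁻¹' {v}) ↔
      μ (f ⁻¹' {u} ∩ g ⁻¹' {v}) = μ (f ⁻¹' {u}) * μ (g ⁻¹' {v}) := by
    intro u v
    rw [measureReal_def, measureReal_def, measureReal_def, ← ENNReal.toReal_mul]
    exact ENNReal.toReal_eq_toReal_iff' (measure_ne_top _ _)
      (ENNReal.mul_ne_top (measure_ne_top _ _) (measure_ne_top _ _))
  simp_rw [key]
  constructor
  · intro h u v
    exact h.measure_inter_preimage_eq_mul _ _ (measurableSet_singleton u)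
      (measurableSet_singleton v)
  · intro h
    rw [indepFun_iff_map_prod_eq_prod_map_map hf.aemeasurable hg.aemeasurable]
    -- On a countable space, the joint law and the product of the marginals need only be compared at
    -- points.
    refine Measure.ext_of_singleton fun ⟨u, v⟩ => ?_
    rw [Measure.map_apply (hf.prodMk hg) (measurableSet_singleton _),
      ← Set.singleton_prod_singleton, Measure.prod_prod,
      Measure.map_apply hf (measurableSet_singleton _),
      Measure.map_apply hg (measurableSet_singleton _), ← h u v]
    rfl

variable {n : ℕ} {a : Fin n → ℕ} {Ω : Type*} [MeasurableSpace Ω] (μ : Measure Ω)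
  [IsProbabilityMeasure μ] {X : ∀ k, Ω → Fin (a k)}

/-- Contraction is marginalisation: the event is the disjoint union of the atoms that are summed. -/
lemma eval_matrix (hX : ∀ k, Measurable (X k)) (s : IndepStatement n)
    (u : ∀ k : s.left, Fin (a k)) (v : ∀ k : s.right, Fin (a k)) :
    MvPolynomial.eval (probTensor μ X) (s.matrix ℝ a u v) =
      μ.real ((fun ω => s.left.restrict (fun k => X k ω)) ⁻¹' {u} ∩
        (fun ω => s.right.restrict (fun k => X k ω)) ⁻¹' {v}) := by
  have hmeas : Measurable fun ω => (fun k => X k ω : Index a) := measurable_pi_lambda _ hX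
  have hset : ((fun ω => s.left.restrict (fun k => X k ω)) ⁻¹' {u} ∩
        (fun ω => s.right.restrict (fun k => X k ω)) ⁻¹' {v}) =
      (fun ω => (fun k => X k ω : Index a)) ⁻¹' (Finset.univ.filter fun x : Index a =>
        s.left.restrict x = u ∧ s.right.restrict x = v) := by
    ext ω
    simp
  rw [hset, ← map_measureReal_apply hmeas (Finset.measurableSet _), ← sum_measureReal_singleton,
    IndepStatement.matrix, Matrix.of_apply, map_sum]
  refine Finset.sum_congr rfl fun x _ => ?_
  rw [MvPolynomial.eval_X, map_measureReal_apply hmeas (measurableSet_singleton _), probTensor]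
  congr 1
  ext ω
  simp [funext_iff]

/-- A statement holds if and only if the 2-minors of its matrix vanish at the probability
tensor. -/
theorem IndepStatement.holds_iff (hX : ∀ k, Measurable (X k)) (s : IndepStatement n) :
    s.Holds μ X ↔ ∀ d ∈ unorderedMinors 2 (s.matrix ℝ a),
      MvPolynomial.eval (probTensor μ X) d = 0 := by
  have hmeas : Measurable fun ω => (fun k => X k ω : Index a) := measurable_pi_lambda _ hX
  set f := fun ω => s.left.restrict (fun k => X k ω) with hf
  set g := fun ω => s.right.restrict (fun k => X k ω) with hg
  have hfm : Measurable f := measurable_pi_lambda _ fun k => hX k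
  have hgm : Measurable g := measurable_pi_lambda _ fun k => hX k
  rw [IndepStatement.Holds, indepFun_iff_measureReal_singleton μ hfm hgm]
  constructor
  · rintro h _ ⟨p, q, rfl⟩
    rw [Matrix.det_fin_two]
    simp only [Matrix.submatrix_apply, map_sub, map_mul, eval_matrix μ hX, ← hf, ← hg, h]
    ring
  · intro h u v
    have hrow : ∀ u, ∑ v, μ.real (f ⁻¹' {u} ∩ g ⁻¹' {v}) = μ.real (f ⁻¹' {u}) := by
      intro u
      have := sum_measureReal_preimage_singleton (μ := μ.restrict (f ⁻¹' {u})) (f := g)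
        Finset.univ (fun v _ => hgm (measurableSet_singleton v))
      simpa [measureReal_restrict_apply, hgm (measurableSet_singleton _), Set.inter_comm] using this
    have hcol : ∀ v, ∑ u, μ.real (f ⁻¹' {u} ∩ g ⁻¹' {v}) = μ.real (g ⁻¹' {v}) := by
      intro v
      have := sum_measureReal_preimage_singleton (μ := μ.restrict (g ⁻¹' {v})) (f := f)
        Finset.univ (fun v _ => hfm (measurableSet_singleton v))
      simpa [measureReal_restrict_apply, hfm (measurableSet_singleton _)] using this
    have htot : ∑ u, μ.real (f ⁻¹' {u}) = 1 := by
      have := sum_measureReal_preimage_singleton (μ := μ) (f := f)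
        Finset.univ (fun v _ => hfm (measurableSet_singleton v))
      simpa using this
    have hminor : ∀ u u' v v', μ.real (f ⁻¹' {u} ∩ g ⁻¹' {v}) * μ.real (f ⁻¹' {u'} ∩ g ⁻¹' {v'}) =
        μ.real (f ⁻¹' {u} ∩ g ⁻¹' {v'}) * μ.real (f ⁻¹' {u'} ∩ g ⁻¹' {v}) := by
      intro u u' v v'
      by_cases hu : u = u'
      · subst hu
        ring
      by_cases hv : v = v'
      · subst hv
        ring
      have := h _ (exists_unorderedMinor_two (s.matrix ℝ a) hu hv)
      simp only [map_sub, map_mul, eval_matrix μ hX, ← hf, ← hg] at this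
      exact sub_eq_zero.1 this
    -- Multiplying by the total mass 1 creates products of two entries; the minors exchange their
    -- columns, and the double sum factors into the two marginals.
    calc μ.real (f ⁻¹' {u} ∩ g ⁻¹' {v})
        = ∑ u', ∑ v', μ.real (f ⁻¹' {u} ∩ g ⁻¹' {v}) * μ.real (f ⁻¹' {u'} ∩ g ⁻¹' {v'}) := by
          simp_rw [← Finset.mul_sum, hrow, htot, mul_one]
      _ = ∑ u', ∑ v', μ.real (f ⁻¹' {u} ∩ g ⁻¹' {v'}) * μ.real (f ⁻¹' {u'} ∩ g ⁻¹' {v}) := by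
          simp_rw [hminor u _ v]
      _ = μ.real (f ⁻¹' {u}) * μ.real (g ⁻¹' {v}) := by
          simp_rw [← Finset.sum_mul, hrow, ← Finset.mul_sum, hcol]

/-- A set of statements holds if and only if the probability tensor is a zero of its
independence ideal. -/
theorem forall_holds_iff (hX : ∀ k, Measurable (X k)) (C : Set (IndepStatement n)) :
    (∀ s ∈ C, s.Holds μ X) ↔
      ∀ f ∈ indepIdeal ℝ a C, MvPolynomial.eval (probTensor μ X) f = 0 := by
  have : (∀ f ∈ indepIdeal ℝ a C, MvPolynomial.eval (probTensor μ X) f = 0) ↔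
      indepIdeal ℝ a C ≤ RingHom.ker (MvPolynomial.eval (probTensor μ X)) := Iff.rfl
  rw [this, indepIdeal, Ideal.span_le, Set.iUnion₂_subset_iff]
  exact forall₂_congr fun s _ => IndepStatement.holds_iff μ hX s

end Model

/-! ### The Gröbner basis of the flattening minors -/

section Groebner

variable {K : Type*} [Field K] {n : ℕ} {a : Fin n → ℕ}

lemma X_mul_X_eq_monomial {σ : Type*} (x y : σ) :
    (MvPolynomial.X x * MvPolynomial.X y : MvPolynomial σ K) =
      MvPolynomial.monomial (Finsupp.single x 1 + Finsupp.single y 1) 1 := by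
  rw [MvPolynomial.X, MvPolynomial.X, MvPolynomial.monomial_mul, mul_one]

lemma degree_binomial {σ : Type*} (m : MonomialOrder σ) {u v : σ →₀ ℕ}
    (h : m.toSyn v < m.toSyn u) :
    m.degree (MvPolynomial.monomial u (1 : K) - MvPolynomial.monomial v 1) = u := by
  classical
  rw [m.degree_sub_of_lt] <;> simp [m.degree_monomial, h]

lemma binomial_ne_zero {σ : Type*} {u v : σ →₀ ℕ} (h : v ≠ u) :
    MvPolynomial.monomial u (1 : K) - MvPolynomial.monomial v 1 ≠ 0 := by
  rw [Ne, sub_eq_zero]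
  intro h'
  exact h (MvPolynomial.monomial_left_injective one_ne_zero h').symm

/-- A finite set of 2-minors of flattenings in two directions, which contains each of them up to
sign, is a Gröbner basis for the graded reverse lexicographic order, if the order of the variables
and the labelling of the multi-indices are compatible with the exchange of entries. -/
theorem isGroebnerBasis_of_swapMinors {T : Type*} [Nonempty T] (lo : LinearOrder (Index a))
    (lab : T → Index a → ℕ) (hinj : ∀ x y, (∀ t, lab t x = lab t y) → x = y) (i j : Fin n)
    (hupd : ∀ l, l = i ∨ l = j → ∀ (x : Index a) v, v < x l → lo.lt (Function.update x l v) x)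
    (hlt : ∀ x y, lo.lt x y → x i ≤ y i → x j ≤ y j → ∀ t, lab t x ≤ lab t y)
    (hswap : ∀ l, l = i ∨ l = j → ∀ (x y : Index a) t,
      (lab t (Function.update x l (y l)) = lab t x ∧ lab t (Function.update y l (x l)) = lab t y) ∨
      (lab t (Function.update x l (y l)) = lab t y ∧ lab t (Function.update y l (x l)) = lab t x))
    {G : Set (TensorRing K a)} (hfin : G.Finite)
    (hG : G ⊆ swapMinors K a i ∪ swapMinors K a j)
    (hG' : ∀ d ∈ swapMinors K a i ∪ swapMinors K a j, d ∈ G ∨ -d ∈ G) :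
    IsGroebnerBasis (@degRevLex (Index a) lo _) G := by
  have hsub : ∀ d, (d ∈ swapMinors K a i ∪ swapMinors K a j) ↔
      ∃ l, (l = i ∨ l = j) ∧ d ∈ swapMinors K a l := by
    intro d
    constructor
    · rintro (h | h)
      exacts [⟨i, .inl rfl, h⟩, ⟨j, .inr rfl, h⟩]
    · rintro ⟨l, rfl | rfl, h⟩
      exacts [.inl h, .inr h]
  refine isGroebnerBasis_of_unique_standard _ (multidegree lab) hfin ?_ ?_
  · intro g hg
    obtain ⟨l, hl, x, y, -, -, rfl⟩ := (hsub g).1 (hG hg)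
    rw [X_mul_X_eq_monomial, X_mul_X_eq_monomial, map_sub, toricMap_monomial, toricMap_monomial,
      sub_eq_zero]
    congr 1
    funext t
    simp only [multidegree_apply, Finsupp.mapDomain_add, Finsupp.mapDomain_single]
    rcases hswap l hl x y t with ⟨h1, h2⟩ | ⟨h1, h2⟩
    · rw [h1, h2]
    · rw [h1, h2, add_comm]
  · have key : ∀ u : Index a →₀ ℕ,
        (∀ g ∈ G, g ≠ 0 → ¬ (@degRevLex (Index a) lo _).degree g ≤ u) → IsMultichain lab u := by
      intro u hu
      -- If this fails, `x` exceeds `y` in position `i` or `j`, and the exchange there gives a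
      -- binomial whose leading monomial divides the monomial of `u`.
      have main : ∀ x ∈ u.support, ∀ y ∈ u.support, lo.lt x y → ∀ t, lab t x ≤ lab t y := by
        intro x hx y hy hxy
        by_contra hcon
        obtain ⟨l, hl, hyx⟩ : ∃ l, (l = i ∨ l = j) ∧ y l < x l := by
          by_contra! h
          exact hcon (hlt x y hxy (h i (.inl rfl)) (h j (.inr rfl)))
        have hx' : lo.lt (Function.update x l (y l)) x := hupd l hl x _ hyx
        have hy' : lo.lt y (Function.update y l (x l)) := by
          have := hupd l hl (Function.update y l (x l)) (y l) (by simpa using hyx)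
          simpa using this
        -- Otherwise the exchange would turn `x` into `y`, yet it makes `x` smaller.
        have hk : ∃ k, k ≠ l ∧ x k ≠ y k := by
          by_contra! h
          have : Function.update x l (y l) = y := by
            funext k
            by_cases hk : k = l
            · subst hk; simp
            · rw [Function.update_of_ne hk, h k hk]
          exact @lt_asymm _ lo.toPreorder _ _ hxy (this ▸ hx')
        have hmem := (hsub _).2 ⟨l, hl, x, y, hyx.ne', hk, rfl⟩
        rw [X_mul_X_eq_monomial, X_mul_X_eq_monomial] at hmem
        have htrans := @lt_trans _ lo.toPreorder
        -- The exchanged `x` is the smallest of the four variables, so the product of `x` and `y`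
        -- leads.
        have hlt' := @degRevLex_single_add_single_lt (Index a) lo _ _ (Function.update y l (x l))
          x y (htrans hx' (htrans hxy hy')) hx' (htrans hx' hxy)
        have hdeg := degree_binomial (K := K) _ hlt'
        have hne : Finsupp.single (Function.update x l (y l)) 1 +
            Finsupp.single (Function.update y l (x l)) 1 ≠
            Finsupp.single x 1 + Finsupp.single y 1 := by
          intro h
          rw [h] at hlt'
          exact lt_irrefl _ hlt'
        have hle : Finsupp.single x 1 + Finsupp.single y 1 ≤ u := by
          have hxy' : x ≠ y := by
            rintro rfl
            exact @lt_irrefl _ lo.toPreorder _ hxy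
          intro z
          have hx0 := Finsupp.mem_support_iff.1 hx
          have hy0 := Finsupp.mem_support_iff.1 hy
          simp only [Finsupp.add_apply, Finsupp.single_apply]
          split_ifs with h1 h2 h2
          · exact absurd (h1.trans h2.symm) hxy'
          · subst h1; omega
          · subst h2; omega
          · omega
        rcases hG' _ hmem with h | h
        · exact hu _ h (binomial_ne_zero hne) (hdeg.trans_le hle)
        · refine hu _ h (neg_ne_zero.2 (binomial_ne_zero hne)) ?_
          rw [MonomialOrder.degree_neg]
          exact hdeg.trans_le hle
      intro x hx y hy
      rcases @lt_trichotomy _ lo x y with h | rfl | h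
      · exact .inl (main x hx y hy h)
      · exact .inl fun t => le_rfl
      · exact .inr (main y hy x hx h)
    exact fun u v hu hv h => (key u hu).eq_of_multidegree_eq hinj (key v hv) h

/-- The rank of the part of a multi-index outside the positions `i` and `j`. -/
noncomputable def restRank (i j : Fin n) (x : Index a) : ℕ :=
  Fintype.equivFin (∀ k : {k : Fin n // k ≠ i ∧ k ≠ j}, Fin (a k)) fun k => x k

lemma restRank_eq_iff {i j : Fin n} {x y : Index a} :
    restRank i j x = restRank i j y ↔ ∀ k, k ≠ i → k ≠ j → x k = y k := by
  rw [restRank, restRank, Fin.val_inj, Equiv.apply_eq_iff_eq, funext_iff, Subtype.forall]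
  exact forall_congr' fun k => ⟨fun h hi hj => h ⟨hi, hj⟩, fun h hk => h hk.1 hk.2⟩

lemma restRank_update {i j l : Fin n} (hl : l = i ∨ l = j) (x : Index a) (v : Fin (a l)) :
    restRank i j (Function.update x l v) = restRank i j x := by
  rw [restRank_eq_iff]
  intro k hi hj
  rw [Function.update_of_ne]
  rintro rfl
  exact hl.elim hi hj

/-- The labels of a multi-index: its entries in positions `i` and `j` and the rank of its other
entries. -/
noncomputable def indexLabel (i j : Fin n) : Fin 3 → Index a → ℕ :=
  ![restRank i j, fun x => x i, fun x => x j]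

lemma indexLabel_injective {i j : Fin n} {x y : Index a}
    (h : ∀ t, indexLabel i j t x = indexLabel i j t y) : x = y := by
  have h0 : restRank i j x = restRank i j y := h 0
  have h1 : (x i : ℕ) = y i := h 1
  have h2 : (x j : ℕ) = y j := h 2
  funext k
  by_cases hi : k = i
  · subst hi; exact Fin.ext h1
  by_cases hj : k = j
  · subst hj; exact Fin.ext h2
  exact restRank_eq_iff.1 h0 k hi hj

/-- The lexicographic key of a multi-index, in which the entries outside the positions `i` and `j`
come first. -/
noncomputable def indexKey (i j : Fin n) (x : Index a) : ℕ ×ₗ ℕ ×ₗ ℕ :=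
  toLex (restRank i j x, toLex ((x i : ℕ), (x j : ℕ)))

lemma indexKey_injective (i j : Fin n) : Function.Injective (indexKey (a := a) i j) := by
  intro x y h
  have h' : (restRank i j x, toLex ((x i : ℕ), (x j : ℕ))) =
    (restRank i j y, toLex ((y i : ℕ), (y j : ℕ))) := h
  obtain ⟨h0, h12⟩ := Prod.ext_iff.1 h'
  obtain ⟨h1, h2⟩ := Prod.ext_iff.1 (toLex.injective h12)
  apply indexLabel_injective (i := i) (j := j)
  intro t
  fin_cases t
  exacts [h0, h1, h2]

lemma indexKey_lt_iff {i j : Fin n} {x y : Index a} :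
    indexKey i j x < indexKey i j y ↔ restRank i j x < restRank i j y ∨
      restRank i j x = restRank i j y ∧ (x i < y i ∨ (x i = y i ∧ x j < y j)) := by
  simp [indexKey, Prod.Lex.toLex_lt_toLex, Fin.val_inj]

/-- The linear order on the multi-indices given by the lexicographic keys. -/
@[reducible] noncomputable def indexOrder (a : Fin n → ℕ) (i j : Fin n) : LinearOrder (Index a) :=
  LinearOrder.lift' (indexKey i j) (indexKey_injective i j)

lemma indexOrder_lt_iff {i j : Fin n} {x y : Index a} :
    (indexOrder a i j).lt x y ↔ restRank i j x < restRank i j y ∨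
      restRank i j x = restRank i j y ∧ (x i < y i ∨ (x i = y i ∧ x j < y j)) :=
  Iff.trans Iff.rfl indexKey_lt_iff

/-- The 2-minors of two flattenings form a Gröbner basis. -/
theorem isGroebnerBasis_minors_flattening (i j : Fin n) {N N' : ℕ}
    (e : Fin N ≃ (∀ k : {k : Fin n // k ≠ i}, Fin (a k)))
    (e' : Fin N' ≃ (∀ k : {k : Fin n // k ≠ j}, Fin (a k))) :
    IsGroebnerBasis (@degRevLex (Index a) (indexOrder a i j) _)
      (minors 2 (flattening K a i e) ∪ minors 2 (flattening K a j e')) := by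
  refine isGroebnerBasis_of_swapMinors (indexOrder a i j) (indexLabel i j)
    (fun _ _ => indexLabel_injective) i j ?_ ?_ ?_ ((minors_finite _ _).union (minors_finite _ _))
    ?_ ?_
  · intro l hl x v hv
    rw [indexOrder_lt_iff, restRank_update hl]
    refine .inr ⟨rfl, ?_⟩
    by_cases hli : l = i
    · subst hli
      exact .inl (by simpa using hv)
    · obtain rfl : l = j := hl.resolve_left hli
      exact .inr (by simpa [Function.update_of_ne (Ne.symm hli)] using hv)
  · intro x y hxy h1 h2 t
    -- No exchange alters this label, so it must be sorted by the variable order itself; this is why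
    -- it comes first in the key.
    have h0 : restRank i j x ≤ restRank i j y := by
      rcases indexOrder_lt_iff.1 hxy with h | h
      exacts [h.le, h.1.le]
    fin_cases t
    exacts [h0, h1, h2]
  · intro l hl x y t
    have hcoord : ∀ k, ((Function.update x l (y l) k = x k ∧ Function.update y l (x l) k = y k) ∨
        (Function.update x l (y l) k = y k ∧ Function.update y l (x l) k = x k)) := by
      intro k
      by_cases hk : k = l
      · subst hk; simp
      · simp [Function.update_of_ne hk]
    fin_cases t
    · exact .inl ⟨restRank_update hl _ _, restRank_update hl _ _⟩
    · exact (hcoord i).imp (fun h => ⟨congrArg Fin.val h.1, congrArg Fin.val h.2⟩)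
        (fun h => ⟨congrArg Fin.val h.1, congrArg Fin.val h.2⟩)
    · exact (hcoord j).imp (fun h => ⟨congrArg Fin.val h.1, congrArg Fin.val h.2⟩)
        (fun h => ⟨congrArg Fin.val h.1, congrArg Fin.val h.2⟩)
  · rw [← unorderedMinors_flattening i e, ← unorderedMinors_flattening j e']
    exact Set.union_subset_union (minors_subset_unorderedMinors _ _)
      (minors_subset_unorderedMinors _ _)
  · rw [← unorderedMinors_flattening i e, ← unorderedMinors_flattening j e']
    rintro d (hd | hd)
    · exact (mem_minors_or_neg_mem _ hd).imp .inl .inl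
    · exact (mem_minors_or_neg_mem _ hd).imp .inr .inr

end Groebner

end TensorIndep

theorem corollary3 (K : Type*) [Field K] {n : ℕ} (a : Fin n → ℕ)
    {Ω : Type*} [MeasurableSpace Ω] (μ : MeasureTheory.Measure Ω)
    [MeasureTheory.IsProbabilityMeasure μ]
    (X : ∀ k, Ω → Fin (a k)) (hX : ∀ k, Measurable (X k)) (i j : Fin n) :
    -- the real independence ideal cuts out the independence model
    ((∀ s ∈ ({TensorIndep.oneVsRest i, TensorIndep.oneVsRest j} :
          Set (TensorIndep.IndepStatement n)), s.Holds μ X) ↔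
      ∀ f ∈ TensorIndep.indepIdeal ℝ a {TensorIndep.oneVsRest i, TensorIndep.oneVsRest j},
        MvPolynomial.eval (TensorIndep.probTensor μ X) f = 0) ∧
    -- the independence ideal is the double determinantal ideal of the slices of the tensor
    (i ≠ j → ∀ (r : ℕ) (e : Fin r ≃ (∀ k : {k : Fin n // k ≠ i ∧ k ≠ j}, Fin (a k))),
      TensorIndep.indepIdeal K a {TensorIndep.oneVsRest i, TensorIndep.oneVsRest j} =
        TensorIndep.doubleDetIdeal (fun p => TensorIndep.slice K a i j (e p)) 2 2) ∧
    -- it is generated by the 2-minors of an `i`-th and a `j`-th flattening matrix, and these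
    -- minors form a Gröbner basis
    ∃ m : MonomialOrder.{0, 0} (TensorIndep.Index a),
      ∀ (N N' : ℕ) (e : Fin N ≃ (∀ k : {k : Fin n // k ≠ i}, Fin (a k)))
        (e' : Fin N' ≃ (∀ k : {k : Fin n // k ≠ j}, Fin (a k))),
        TensorIndep.indepIdeal K a {TensorIndep.oneVsRest i, TensorIndep.oneVsRest j} =
          Ideal.span (TensorIndep.minors 2 (TensorIndep.flattening K a i e) ∪
            TensorIndep.minors 2 (TensorIndep.flattening K a j e')) ∧
        TensorIndep.IsGroebnerBasis m
          (TensorIndep.minors 2 (TensorIndep.flattening K a i e) ∪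
            TensorIndep.minors 2 (TensorIndep.flattening K a j e')) := by
  exact ⟨TensorIndep.forall_holds_iff μ hX _,
    fun hij _ e => TensorIndep.indepIdeal_pair_eq_doubleDetIdeal e hij,
    -- The monomial order found by unification is built from `a`, `i` and `j` alone, so it serves
    -- all column enumerations.
    _, fun _ _ e e' => ⟨TensorIndep.indepIdeal_pair_eq_span_minors_flattening i j e e',
      TensorIndep.isGroebnerBasis_minors_flattening i j e e'⟩⟩
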